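/- Let $(R,\mathfrak m)$ be a commutative Noetherian local ring, let $x\in R$, and put $\mathfrak a=(x)$, $X=\operatorname{Spec}(R)\setminus\{\mathfrak m\}$ and $Y=V(\mathfrak a)\setminus\{\mathfrak m\}\subseteq X$. For a finitely generated $R$-module $M$ let $\mathcal F=\widetilde M|_X$ be the associated sheaf on $X$. Let $\widehat X$ be the formal completion of $X$ along $Y$, that is, the space $Y$ with the sheaf of rings $\mathcal O_{\widehat X}=\varprojlim_n(\mathcal O_X/\mathfrak a^n\mathcal O_X)|_Y$, and let $\widehat{\mathcal F}=\varprojlim_n(\mathcal F/\mathfrak a^n\mathcal F)|_Y$. (1) Let $M$ be a finitely generated $R$-module such that $x$ is a nonzerodivisor on $M$, $M$ is complete (and separated) in the $x$-adic topology, and the local cohomology modules $H^1_{\mathfrak m}(M)$ and $H^2_{\mathfrak m}(M)$ are each annihilated by some power of $x$. Then the natural map $H^0(X,\mathcal F)\to H^0(\widehat X,\widehat{\mathcal F})$ is an isomorphism of $R$-modules. (2) Suppose that $R$ is $\mathfrak m$-adically complete, that $\dim R>2$, that $R$ is generalized Cohen–Macaulay (i.e. $H^i_{\mathfrak m}(R)$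 has finite length for all $i<\dim R$), and that $x\in\mathfrak m$ is a nonzerodivisor of $R$. Then $Y$ is $G_2$ in $X$, i.e. the natural ring homomorphism $H^0(X,\mathcal O_X)\to H^0(\widehat X,\mathcal O_{\widehat X})$ is an isomorphism. -/

import Mathlib

open AlgebraicGeometry CategoryTheory TopologicalSpace Opposite IsLocalRing

universe u

noncomputable section

namespace FormalGeometry

section Completion

variable (R : Type u) [CommRing R]

/-- The punctured spectrum `X = Spec R ∖ {𝔪}` of a local ring, as an open subset of `Spec R`. -/
def puncturedSpectrum [IsLocalRing R] : (Spec (CommRingCat.of R)).Opens :=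
  ⟨{closedPoint R}ᶜ, (isClosed_singleton_closedPoint R).isOpen_compl⟩

variable {R}

/-- The closed subset `Y = V(𝔞) ∖ {𝔪}` of the punctured spectrum. -/
def puncturedLocus [IsLocalRing R] (a : Ideal R) : Set (PrimeSpectrum R) :=
  PrimeSpectrum.zeroLocus a \ {closedPoint R}

/-- `Y = V(𝔞) ∖ {𝔪}` with the subspace topology. -/
def puncturedLocusTop [IsLocalRing R] (a : Ideal R) : TopCat.{u} :=
  TopCat.of (puncturedLocus a)

/-- The point of `Spec R` underlying a point of `Y`. -/
def toSpec [IsLocalRing R] {a : Ideal R} (y : puncturedLocusTop a) : PrimeSpectrum R :=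
  Subtype.val (p := fun q => q ∈ puncturedLocus a) y

/-- The module `lim_n M_p / 𝔞ⁿ M_p`, where `M_p / 𝔞ⁿ M_p` is the stalk at `p` of the
quasi-coherent sheaf `F / 𝔞ⁿ F`, `F` being the sheaf associated to `M`. -/
abbrev CompletedLocalization (a : Ideal R) (M : Type u) [AddCommGroup M] [Module R M]
    (p : PrimeSpectrum R) : Type u :=
  AdicCompletion (a.map (algebraMap R (Localization p.asIdeal.primeCompl)))
    (LocalizedModule p.asIdeal.primeCompl M)

/-- A family of elements `s z ∈ lim_n M_z / 𝔞ⁿ M_z` over an open subset of `Y` is a fraction at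
level `n` if there are `m ∈ M`, `f ∈ R` such that `f ∉ z` and `s z ≡ m / f` in `M_z / 𝔞ⁿ M_z`
for all `z`. -/
def isFractionAt [IsLocalRing R] (a : Ideal R) (M : Type u) [AddCommGroup M] [Module R M]
    (n : ℕ) :
    TopCat.PrelocalPredicate
      (fun y : puncturedLocusTop a => CompletedLocalization a M (toSpec y)) where
  pred {U} s := ∃ (m : M) (f : R), ∀ z : U, ∃ hf : f ∉ (toSpec z.1).asIdeal,
    (s z).val n = Submodule.Quotient.mk (LocalizedModule.mk m ⟨f, hf⟩)
  res := by
    rintro U V i s ⟨m, f, h⟩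
    exact ⟨m, f, fun z => h (i z)⟩

/-- The predicate that cuts out the sections of the completion `F̂ = lim_n (F / 𝔞ⁿ F)|_Y`
of the sheaf `F` associated to `M`.
For each `n`, the sections over `V ⊆ Y` of the inverse image of `F / 𝔞ⁿ F` are the families
of elements of the stalks `M_z / 𝔞ⁿ M_z`, `z ∈ V`, that locally on `V` come from a fraction `m / f`.
A section of the inverse limit is a compatible sequence of these, that is, a family of elements
of `lim_n M_z / 𝔞ⁿ M_z` which, for every `n`, is modulo `𝔞ⁿ` locally a fraction; the
neighbourhoods may depend on `n`. -/
def completionPredicate [IsLocalRing R] (a : Ideal R) (M : Type u) [AddCommGroup M]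
    [Module R M] :
    TopCat.LocalPredicate
      (fun y : puncturedLocusTop a => CompletedLocalization a M (toSpec y)) where
  pred s := ∀ n, (isFractionAt a M n).sheafify.pred s
  res i s h n := (isFractionAt a M n).sheafify.res i s (h n)
  locality s h n := (isFractionAt a M n).sheafify.locality s fun x => by
    obtain ⟨V, hx, i, hV⟩ := h x
    exact ⟨V, hx, i, hV n⟩

variable [IsLocalRing R] (a : Ideal R) (M : Type u) [AddCommGroup M] [Module R M]

/-- The sections of `F̂` over `V ⊆ Y`, as a submodule of a product. -/
def completionSections (V : Opens (puncturedLocusTop a)) :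
    Submodule R (∀ y : V, CompletedLocalization a M (toSpec y.1)) where
  carrier := {s | (completionPredicate a M).pred s}
  add_mem' {s t} hs ht n x := by
    obtain ⟨V₁, h₁, i₁, m₁, f₁, w₁⟩ := hs n x
    obtain ⟨V₂, h₂, i₂, m₂, f₂, w₂⟩ := ht n x
    refine ⟨V₁ ⊓ V₂, ⟨h₁, h₂⟩, Opens.infLELeft _ _ ≫ i₁, f₂ • m₁ + f₁ • m₂, f₁ * f₂, fun z => ?_⟩
    obtain ⟨hf₁, e₁⟩ := w₁ ⟨z.1, z.2.1⟩
    obtain ⟨hf₂, e₂⟩ := w₂ ⟨z.1, z.2.2⟩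
    refine ⟨(toSpec z.1).asIdeal.primeCompl.mul_mem hf₁ hf₂, (congrArg₂ (· + ·) e₁ e₂).trans ?_⟩
    exact congrArg Submodule.Quotient.mk (LocalizedModule.mk_add_mk (m1 := m₁) (m2 := m₂)
      (s1 := ⟨f₁, hf₁⟩) (s2 := ⟨f₂, hf₂⟩))
  zero_mem' n x := ⟨V, x.2, 𝟙 _, 0, 1, fun z =>
    ⟨(toSpec z.1).asIdeal.primeCompl.one_mem,
      (congrArg Submodule.Quotient.mk (LocalizedModule.zero_mk _)).symm⟩⟩
  smul_mem' r s hs n x := by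
    obtain ⟨W, h, i, m, f, w⟩ := hs n x
    refine ⟨W, h, i, r • m, f, fun z => ?_⟩
    obtain ⟨hf, e⟩ := w z
    refine ⟨hf, (congrArg (r • ·) e).trans ?_⟩
    exact congrArg Submodule.Quotient.mk (LocalizedModule.smul'_mk (S := (toSpec z.1).asIdeal.primeCompl)
      r m ⟨f, hf⟩)

/-- The sections of `O_X̂` over `V ⊆ Y`, as a subring of a product. -/
def completionSubring (V : Opens (puncturedLocusTop a)) :
    Subring (∀ y : V, CompletedLocalization a R (toSpec y.1)) where
  __ := (completionSections a R V).toAddSubgroup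
  one_mem' n x := ⟨V, x.2, 𝟙 _, 1, 1, fun z =>
    ⟨(toSpec z.1).asIdeal.primeCompl.one_mem,
      congrArg (Ideal.Quotient.mk _) (OreLocalization.one_def)⟩⟩
  mul_mem' {s t} hs ht n x := by
    obtain ⟨V₁, h₁, i₁, m₁, f₁, w₁⟩ := hs n x
    obtain ⟨V₂, h₂, i₂, m₂, f₂, w₂⟩ := ht n x
    refine ⟨V₁ ⊓ V₂, ⟨h₁, h₂⟩, Opens.infLELeft _ _ ≫ i₁, m₁ * m₂, f₁ * f₂, fun z => ?_⟩
    obtain ⟨hf₁, e₁⟩ := w₁ ⟨z.1, z.2.1⟩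
    obtain ⟨hf₂, e₂⟩ := w₂ ⟨z.1, z.2.2⟩
    refine ⟨(toSpec z.1).asIdeal.primeCompl.mul_mem hf₁ hf₂, (congrArg₂ (· * ·) e₁ e₂).trans ?_⟩
    exact congrArg (Ideal.Quotient.mk _) (LocalizedModule.mk_mul_mk (a₁ := m₁) (a₂ := m₂)
      (s₁ := ⟨f₁, hf₁⟩) (s₂ := ⟨f₂, hf₂⟩))

/-- The completion `F̂` of the sheaf associated to `M` along `Y`, a sheaf of `R`-modules on `Y`. -/
def completionSheaf : TopCat.Sheaf (ModuleCat.{u} R) (puncturedLocusTop a) where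
  obj :=
    { obj := fun V => ModuleCat.of R (completionSections a M V.unop)
      map := fun {V W} i => ModuleCat.ofHom
        { toFun := fun s => ⟨fun y => s.1 (i.unop y), (completionPredicate a M).res i.unop s.1 s.2⟩
          map_add' := fun _ _ => rfl
          map_smul' := fun _ _ => rfl } }
  property := (TopCat.Presheaf.isSheaf_iff_isSheaf_comp (forget (ModuleCat R)) _).2
    (TopCat.subsheafToTypes (completionPredicate a M)).2

/-- The formal completion `X̂` of the punctured spectrum `X` along `Y`, a ringed space:
the topological space `Y` with the sheaf of rings `O_X̂ = lim_n (O_X / 𝔞ⁿ O_X)|_Y`. -/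
def formalCompletion : RingedSpace.{u, u} where
  carrier := puncturedLocusTop a
  presheaf :=
    { obj := fun V => CommRingCat.of (completionSubring a V.unop)
      map := fun {V W} i => CommRingCat.ofHom
        { toFun := fun s =>
            ⟨fun y => s.1 (i.unop y), (completionPredicate a R).res i.unop s.1 (id s.2)⟩
          map_one' := rfl
          map_mul' := fun _ _ => rfl
          map_zero' := rfl
          map_add' := fun _ _ => rfl } }
  IsSheaf := (TopCat.Presheaf.isSheaf_iff_isSheaf_comp (forget CommRingCat) _).2
    (TopCat.subsheafToTypes (completionPredicate a R)).2

/-- `H⁰(X, F)` as an `R`-module, where `F` is the restriction to the punctured spectrum `X` of the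
sheaf associated to `M`. -/
abbrev H0 : ModuleCat.{u} R :=
  (modulesSpecToSheaf.obj (tilde (R := CommRingCat.of R) (ModuleCat.of R M))).presheaf.obj
    (op (puncturedSpectrum R))

/-- The natural `R`-linear map `H⁰(X, F) → H⁰(X̂, F̂)`, where `F` is the restriction to `X` of the
sheaf associated to `M`: it sends a section to the family of its germs along `Y`. -/
def toCompletion :
    H0 (R := R) M →ₗ[R] (completionSheaf a M).presheaf.obj (op ⊤) where
  toFun s :=
    ⟨fun y => AdicCompletion.of _ _
      (Subtype.val (p := (StructureSheaf.isLocallyFraction R M).pred) s ⟨toSpec y.1, y.1.2.2⟩), by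
      intro n x
      obtain ⟨V, hx, i, m, f, w⟩ := Subtype.property
        (p := (StructureSheaf.isLocallyFraction R M).pred) s ⟨toSpec x.1, x.1.2.2⟩
      refine ⟨⟨{y | toSpec y ∈ V.1}, V.2.preimage continuous_subtype_val⟩, hx, homOfLE le_top, m, f,
        fun z => ?_⟩
      obtain ⟨hf, e⟩ := w ⟨toSpec z.1, z.2⟩
      exact ⟨hf, congrArg Submodule.Quotient.mk e⟩⟩
  map_add' s t := by
    refine Subtype.ext (funext fun y => ?_)
    exact map_add (AdicCompletion.of _ _) _ _
  map_smul' r s := by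
    refine Subtype.ext (funext fun y => ?_)
    refine (congrArg (AdicCompletion.of _ _) (congrFun (congrArg Subtype.val
      (IsScalarTower.algebraMap_smul (M := (structureSheafInType R M).obj.obj
        (op (puncturedSpectrum R))) ((structureSheafInType R R).obj.obj
          (op (puncturedSpectrum R))) r s)) ⟨toSpec y.1, y.1.2.2⟩)).trans ?_
    rfl

/-- The natural ring homomorphism `H⁰(X, O_X) → H⁰(X̂, O_X̂)`. -/
def toCompletionRing :
    Γ(Spec (CommRingCat.of R), puncturedSpectrum R) →+*
      (formalCompletion a).presheaf.obj (op ⊤) where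
  toFun s :=
    ⟨fun y => AdicCompletion.of _ _
      (Subtype.val (p := (StructureSheaf.isLocallyFraction R R).pred) s ⟨toSpec y.1, y.1.2.2⟩),
      (toCompletion a R s).2⟩
  map_one' := rfl
  map_mul' s t := rfl
  map_zero' := rfl
  map_add' s t := by
    refine Subtype.ext (funext fun y => ?_)
    exact map_add (AdicCompletion.of _ _) _ _

/-- `Y` is `G₂` in `X` if the natural map `H⁰(X, O_X) → H⁰(X̂, O_X̂)` is an isomorphism. -/
def IsG2 : Prop :=
  Function.Bijective (toCompletionRing a)

end Completion

/-- A local ring `(R, 𝔪)` is generalized Cohen-Macaulay if the local cohomology modules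
`Hⁱ_𝔪(R)`, `i < dim R`, have finite length. -/
def IsGeneralizedCohenMacaulay (R : Type u) [CommRing R] [IsLocalRing R] : Prop :=
  ∀ i : ℕ, (i : WithBot ℕ∞) < ringKrullDim R →
    IsFiniteLength R ((localCohomology (maximalIdeal R) i).obj (ModuleCat.of R R))

end FormalGeometry

end

-- Write `H⁰` for the sections of `F` over `X`, and let `xᵏ` kill `H¹_𝔪(M)` and `H²_𝔪(M)`. Two facts
-- carry the proof. (a) Since `H⁰/M` embeds in `H¹_𝔪(M)`, `xᵏ` carries every section over `X` into
-- the image of `M` (`exists_pow_smul_eq_toOpenₗ`). (b) The obstruction to lifting a section of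
-- `F/xⁿF` to `F` lies in `H¹(X, F) = H²_𝔪(M)`. The obstruction of the reduction mod `xⁿ` of a
-- section mod `xⁿ⁺ᵏ` is `xᵏ` times the obstruction of that section, so it vanishes
-- (`exists_section_germ_eq_mk`).
--
-- Injectivity: a section `s` vanishing in the completion is `xⁿ`-divisible for all `n`, so by (a)
-- `xᵏs` comes from an element of `⋂ xⁿM = 0`, and `x` is regular. Surjectivity: by (b) a formal
-- section `σ` is approximated by `tₙ ∈ H⁰` with `σ ≡ tₙ` mod `xⁿ`. The elements `cₙ = xᵏtₙ` of `M`
-- form a Cauchy sequence, and dividing its limit by `xᵏ` gives the preimage of `σ`.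
--
-- No sheaf cohomology is used: by Deligne's formula sections over `X` are linear maps `𝔪ᵃ → M` up
-- to shrinking `𝔪ᵃ`, and local cohomology is the colimit of `Ext(R/𝔪ᵃ, M)`, so (a) and (b) become
-- long exact sequences of `Ext`. Part (2) is the case `M = R`, as finite length modules are killed
-- by a power of `x ∈ 𝔪`.

universe v w t

/-! ### The derived-functor `Ext` computed by cocycles on projective resolutions. -/

section ExtComparison

open Limits

lemma HomologicalComplex.homologyUnop_inv_naturality {ι : Type*} {V : Type*} [Category V]
    [HasZeroMorphisms V] {c : ComplexShape ι} {K L : HomologicalComplex Vᵒᵖ c} (ψ : K ⟶ L) (i : ι)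
    [K.HasHomology i] [L.HasHomology i] :
    (homologyMap ψ i).unop ≫ (K.homologyUnop i).inv =
      (L.homologyUnop i).inv ≫ homologyMap ((unopFunctor V c).map ψ.op) i := by
  refine (Iso.eq_inv_comp _).2 ((Category.assoc _ _ _).symm.trans ((Iso.comp_inv_eq _).2 ?_))
  exact (congrArg Quiver.Hom.unop
    (homologyOp_hom_naturality ((unopFunctor V c).map ψ.op) i))

lemma HomologicalComplex.exists_cycles_of_homology {A : Type*} [Ring A] {ι : Type*}
    {c : ComplexShape ι} (K : HomologicalComplex (ModuleCat.{w} A) c) (i j : ι) (hij : c.next i = j)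
    (f : K.X i) (hf : K.d i j f = 0) : ∃ z : K.cycles i, K.iCycles i z = f := by
  subst hij
  have := (ShortComplex.moduleCat_exact_iff (ShortComplex.mk (K.iCycles i) (K.d i (c.next i))
    (by simp))).1 (ShortComplex.exact_of_f_is_kernel _ (K.cyclesIsKernel i _ rfl)) f hf
  exact this

lemma HomologicalComplex.exists_d_eq_of_homologyπ_eq_zero {A : Type*} [Ring A] {ι : Type*}
    {c : ComplexShape ι} (K : HomologicalComplex (ModuleCat.{w} A) c) (i j : ι) (hij : c.prev j = i)
    (z : K.cycles j) (hz : K.homologyπ j z = 0) : ∃ g : K.X i, K.d i j g = K.iCycles j z := by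
  obtain ⟨g, hg⟩ := (ShortComplex.moduleCat_exact_iff (ShortComplex.mk (K.toCycles i j)
    (K.homologyπ j) (by simp))).1
      (ShortComplex.exact_of_g_is_cokernel _ (K.homologyIsCokernel i j hij)) z hz
  refine ⟨g, ?_⟩
  rw [← K.toCycles_i i j]
  exact congrArg (K.iCycles j) hg

lemma ModuleCat.hom_smul_eq_zero_of_comp_eq {A : Type*} [Ring A] {E E' H H' : ModuleCat.{w} A}
    (a : E ⟶ E') (e : E ≅ H) (e' : E' ⟶ H') (h : H ⟶ H') (w : a ≫ e' = e.hom ≫ h) (y : H) (r : A)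
    (hr : a (r • e.inv y) = 0) : h (r • y) = 0 := by
  have h1 : h (e.hom (r • e.inv y)) = 0 :=
    (ConcreteCategory.congr_hom w (r • e.inv y)).symm.trans ((congrArg e' hr).trans (map_zero _))
  rwa [map_smul, e.inv_hom_id_apply] at h1

variable {R : Type t} [Ring R] {C : Type u} [Category.{v} C] [Abelian C] [Linear R C]
  [EnoughProjectives C]

/-- `Ext` is a left derived functor into the opposite category, so this is naturality of left
derived functors read through `unop`. -/
lemma CategoryTheory.ProjectiveResolution.isoExt_hom_naturality {X X' : C} (g : X' ⟶ X)
    (P : ProjectiveResolution X) (P' : ProjectiveResolution X')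
    (φ : P'.complex ⟶ P.complex) (comm : φ.f 0 ≫ P.π.f 0 = P'.π.f 0 ≫ g) (n : ℕ) (Y : C) :
    ((Ext R C n).map g.op).app Y ≫ (P'.isoExt n Y).hom =
      (P.isoExt n Y).hom ≫ HomologicalComplex.homologyMap
        ((HomologicalComplex.unopFunctor _ _).map
          ((((linearYoneda R C).obj Y).rightOp.mapHomologicalComplex _).map φ).op) n := by
  have h := ProjectiveResolution.isoLeftDerivedObj_inv_naturality g P' P φ comm
    ((linearYoneda R C).obj Y).rightOp n
  have h2 := congrArg Quiver.Hom.unop h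
  have h3 := HomologicalComplex.homologyUnop_inv_naturality
    ((((linearYoneda R C).obj Y).rightOp.mapHomologicalComplex _).map φ) n
  refine (Category.assoc _ _ _).symm.trans ((congrArg (· ≫
    (HomologicalComplex.homologyUnop _ _).inv) h2).trans ((Category.assoc _ _ _).trans
    ((congrArg ((P.isoLeftDerivedObj ((linearYoneda R C).obj Y).rightOp n).inv.unop ≫ ·)
      h3).trans (Category.assoc _ _ _).symm)))

/-- A cocycle `f` on a projective resolution defines a class `ξ` in `Ext`. If `r • ξ` restricts to
zero along a morphism `g`, then `r • f` restricts to a coboundary along any lift of `g`. -/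
lemma CategoryTheory.ProjectiveResolution.exists_class_of_cocycle {X : C}
    (P : ProjectiveResolution X) (n : ℕ) {Y : C} (f : P.complex.X (n + 1) ⟶ Y)
    (hf : P.complex.d (n + 2) (n + 1) ≫ f = 0) :
    ∃ ξ : ((Ext R C (n + 1)).obj (op X)).obj Y, ∀ (X' : C) (g : X' ⟶ X)
      (P' : ProjectiveResolution X') (φ : P'.Hom P g) (r : R),
      ((Ext R C (n + 1)).map g.op).app Y (r • ξ) = 0 →
        ∃ h : P'.complex.X n ⟶ Y, P'.complex.d (n + 1) n ≫ h = φ.hom.f (n + 1) ≫ (r • f) := by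
  obtain ⟨z, hz⟩ := (P.complex.linearYonedaObj R Y).exists_cycles_of_homology (n + 1) (n + 2)
    (by simp) f hf
  refine ⟨(P.isoExt (n + 1) Y).inv ((P.complex.linearYonedaObj R Y).homologyπ (n + 1) z),
    fun X' g P' φ r h0 => ?_⟩
  let ψ : P.complex.linearYonedaObj R Y ⟶ P'.complex.linearYonedaObj R Y :=
    (HomologicalComplex.unopFunctor _ _).map
      ((((linearYoneda R C).obj Y).rightOp.mapHomologicalComplex _).map φ.hom).op
  have comm : φ.hom.f 0 ≫ P.π.f 0 = P'.π.f 0 ≫ g := by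
    simpa using φ.hom_f_zero_comp_π_f_zero
  have key : HomologicalComplex.homologyMap ψ (n + 1)
      ((P.complex.linearYonedaObj R Y).homologyπ (n + 1) (r • z)) = 0 := by
    refine (congrArg (HomologicalComplex.homologyMap ψ (n + 1))
      (((P.complex.linearYonedaObj R Y).homologyπ (n + 1)).hom.map_smul r z)).trans ?_
    exact ModuleCat.hom_smul_eq_zero_of_comp_eq _ (P.isoExt (n + 1) Y) _ _
      (P.isoExt_hom_naturality (R := R) g P' φ.hom comm (n + 1) Y) _ _ h0
  have key2 : (P'.complex.linearYonedaObj R Y).homologyπ (n + 1)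
      (HomologicalComplex.cyclesMap ψ (n + 1) (r • z)) = 0 := by
    rw [← key]
    exact (ConcreteCategory.congr_hom
      (HomologicalComplex.homologyπ_naturality ψ (n + 1)) (r • z)).symm
  obtain ⟨h, hh⟩ := HomologicalComplex.exists_d_eq_of_homologyπ_eq_zero _ n (n + 1) (by simp) _ key2
  refine ⟨h, hh.trans ?_⟩
  refine (ConcreteCategory.congr_hom (HomologicalComplex.cyclesMap_i ψ (n + 1)) (r • z)).trans ?_
  refine (congrArg (ψ.f (n + 1)) (((P.complex.linearYonedaObj R Y).iCycles (n + 1)).hom.map_smul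
    r z)).trans ?_
  exact congrArg (fun t => ψ.f (n + 1) (r • t)) hz

end ExtComparison

/-! ### Annihilated local cohomology, in terms of `Ext(R/Jᵃ, M)`. -/

section LocalCohomology

open Limits

variable {R : Type u} [CommRing R]

/-- The projection `R ⧸ J ⟶ R ⧸ I` for `J ≤ I`. -/
noncomputable abbrev ModuleCat.quotientProj {I J : Ideal R} (h : J ≤ I) :
    ModuleCat.of R (R ⧸ J) ⟶ ModuleCat.of R (R ⧸ I) :=
  ModuleCat.ofHom (Submodule.mapQ J I LinearMap.id h)

lemma localCohomology.exists_map_eq_zero (J : Ideal R) (i : ℕ) (M : ModuleCat.{u} R) (r : R)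
    (h : ∀ z : (localCohomology J i).obj M, r • z = 0) (a : ℕ)
    (ξ : ((Ext R (ModuleCat.{u} R) i).obj (op (ModuleCat.of R (R ⧸ J ^ a)))).obj M) :
    ∃ (b : ℕ) (hb : a ≤ b), ((Ext R (ModuleCat.{u} R) i).map
      (ModuleCat.quotientProj (Ideal.pow_le_pow_right hb : J ^ b ≤ J ^ a)).op).app M (r • ξ) = 0 := by
  let D := diagram (idealPowersDiagram J) i
  have : HasColimit D := hasColimitDiagram.{u, 0} _ _
  let F := (evaluation (ModuleCat.{u} R) (ModuleCat.{u} R)).obj M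
  have hc : IsColimit (F.mapCocone (colimit.cocone D)) :=
    isColimitOfPreserves F (colimit.isColimit D)
  have h0 : ((F.mapCocone (colimit.cocone D)).ι.app (op (op a))) (r • ξ) =
      ((F.mapCocone (colimit.cocone D)).ι.app (op (op a))) (0 : (D ⋙ F).obj (op (op a))) := by
    rw [map_zero]
    refine (map_smul (((F.mapCocone (colimit.cocone D)).ι.app (op (op a))).hom) r ξ).trans ?_
    exact h _
  -- The colimit is filtered, so it is computed on underlying sets, and an element that is zero in
  -- it is already zero at a finite stage.
  have := preservesSmallestFilteredColimits_of_preservesFilteredColimits (forget (ModuleCat.{u} R))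
  have : PreservesColimit (D ⋙ F) (forget (ModuleCat.{u} R)) := inferInstance
  obtain ⟨k, f, g, hk⟩ := Concrete.isColimit_exists_of_rep_eq (D ⋙ F) hc _ _ h0
  refine ⟨k.unop.unop, f.unop.unop.down.down, ?_⟩
  rw [map_zero] at hk
  exact hk

/-- Transfers the vanishing from the `Ext` that defines local cohomology to `Abelian.Ext`, which has
long exact sequences: on a projective resolution both are given by the same cocycle and the same
coboundary. -/
lemma localCohomology.exists_restrict_smul_eq_zero (J : Ideal R) (i : ℕ) (M : ModuleCat.{u} R)
    (r : R) (h : ∀ z : (localCohomology J (i + 1)).obj M, r • z = 0) (a : ℕ)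
    (α : Abelian.Ext (ModuleCat.of R (R ⧸ J ^ a)) M (i + 1)) :
    ∃ (b : ℕ) (hb : a ≤ b), (Abelian.Ext.mk₀
      (ModuleCat.quotientProj (Ideal.pow_le_pow_right hb : J ^ b ≤ J ^ a))).comp (r • α)
        (zero_add _) = 0 := by
  let P := projectiveResolution (ModuleCat.of R (R ⧸ J ^ a))
  obtain ⟨f, hf, rfl⟩ := P.extMk_surjective α (i + 2) rfl
  obtain ⟨ξ, hξ⟩ := P.exists_class_of_cocycle (R := R) i f hf
  obtain ⟨b, hb, h0⟩ := exists_map_eq_zero J (i + 1) M r h a ξ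
  refine ⟨b, hb, ?_⟩
  let g := ModuleCat.quotientProj (Ideal.pow_le_pow_right hb : J ^ b ≤ J ^ a)
  let P' := projectiveResolution (ModuleCat.of R (R ⧸ J ^ b))
  let φ : P'.Hom P g := ⟨ProjectiveResolution.lift g P' P, by
    simpa using ProjectiveResolution.lift_commutes_zero g P' P⟩
  obtain ⟨y, hy⟩ := hξ _ g P' φ r h0
  rw [Abelian.Ext.smul_eq_comp_mk₀, P.extMk_comp_mk₀, ProjectiveResolution.mk₀_comp_extMk _ _ _ _ φ,
    P'.extMk_eq_zero_iff _ _ _ _ i rfl]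
  exact ⟨y, by simpa using hy⟩

end LocalCohomology

/-! ### Linear maps on powers of an ideal: extension to `R` and lifting along `M → M/xⁿM`. -/

section PowersHom

open Limits

variable {R : Type u} [CommRing R]

/-- The short complex `I ⟶ R ⟶ R ⧸ I`. -/
noncomputable abbrev ModuleCat.idealShortComplex (I : Ideal R) : ShortComplex (ModuleCat.{u} R) :=
  ShortComplex.mk (ModuleCat.ofHom (Submodule.subtype I)) (ModuleCat.ofHom (Submodule.mkQ I))
    (by ext x; exact Ideal.Quotient.eq_zero_iff_mem.2 x.2)

lemma ModuleCat.shortExact_idealShortComplex (I : Ideal R) :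
    (ModuleCat.idealShortComplex I).ShortExact where
  exact := by
    rw [ShortComplex.moduleCat_exact_iff]
    intro x hx
    exact ⟨⟨x, (Submodule.Quotient.mk_eq_zero _).1 hx⟩, rfl⟩
  mono_f := (ModuleCat.mono_iff_injective _).2 I.injective_subtype
  epi_g := (ModuleCat.epi_iff_surjective _).2 (Submodule.mkQ_surjective I)

/-- The inclusion `J ⟶ I` for `J ≤ I`. -/
noncomputable abbrev ModuleCat.idealInclusion {I J : Ideal R} (h : J ≤ I) :
    ModuleCat.of R J ⟶ ModuleCat.of R I :=
  ModuleCat.ofHom (Submodule.inclusion h)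

lemma ModuleCat.idealShortComplex_extClass_naturality {I J : Ideal R} (h : J ≤ I) :
    (shortExact_idealShortComplex J).extClass.comp (Abelian.Ext.mk₀ (idealInclusion h))
      (add_zero 1) =
    (Abelian.Ext.mk₀ (quotientProj h)).comp (shortExact_idealShortComplex I).extClass
      (zero_add 1) :=
  ShortComplex.ShortExact.extClass_naturality (shortExact_idealShortComplex J)
    (shortExact_idealShortComplex I)
    { τ₁ := idealInclusion h, τ₂ := 𝟙 _, τ₃ := quotientProj h }

/-- The boundary of `β` in `Ext(R/Jᵃ, M)`, multiplied by `r`, dies on some `R/Jᵇ`; by the long exact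
sequence of `Jᵇ → R → R/Jᵇ`, the restriction of `r • β` then comes from `R`. Degree 0 gives fact
(a), degree 1 gives fact (b). -/
lemma localCohomology.exists_extend_smul_restrict (J : Ideal R) (i : ℕ) (M : ModuleCat.{u} R)
    (r : R) (h : ∀ z : (localCohomology J (i + 1)).obj M, r • z = 0) (a : ℕ)
    (β : Abelian.Ext (ModuleCat.of R ↥(J ^ a)) M i) :
    ∃ (b : ℕ) (hb : J ^ b ≤ J ^ a) (γ : Abelian.Ext (ModuleCat.of R R) M i),
      (Abelian.Ext.mk₀ (ModuleCat.idealShortComplex (J ^ b)).f).comp γ (zero_add i) =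
        (Abelian.Ext.mk₀ (ModuleCat.idealInclusion hb)).comp (r • β) (zero_add i) := by
  obtain ⟨b, hab, h0⟩ := exists_restrict_smul_eq_zero J i M r h a
    ((ModuleCat.shortExact_idealShortComplex (J ^ a)).extClass.comp β (add_comm 1 i))
  have hb : J ^ b ≤ J ^ a := Ideal.pow_le_pow_right hab
  refine ⟨b, hb, Abelian.Ext.contravariant_sequence_exact₁
    (ModuleCat.shortExact_idealShortComplex (J ^ b)) M _ (add_comm 1 i) ?_⟩
  rw [← Abelian.Ext.comp_smul, ← Abelian.Ext.comp_assoc (a₁₂ := 1) _ _ _ (by lia) (by lia)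
    (by lia)] at h0
  rw [← Abelian.Ext.comp_assoc (a₁₂ := 1) _ _ _ (by lia) (by lia) (by lia),
    ModuleCat.idealShortComplex_extClass_naturality, h0]

lemma localCohomology.exists_smul_eq_smul (J : Ideal R) (M : Type u) [AddCommGroup M] [Module R M]
    (r : R) (h : ∀ z : (localCohomology J 1).obj (ModuleCat.of R M), r • z = 0) (a : ℕ)
    (φ : ↥(J ^ a) →ₗ[R] M) :
    ∃ (b : ℕ) (hb : J ^ b ≤ J ^ a) (m : M), ∀ t (ht : t ∈ J ^ b), r • φ ⟨t, hb ht⟩ = t • m := by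
  obtain ⟨b, hb, γ, hγ⟩ := exists_extend_smul_restrict J 0 (ModuleCat.of R M) r h a
    (Abelian.Ext.mk₀ (ModuleCat.ofHom φ))
  obtain ⟨g, rfl⟩ := Abelian.Ext.addEquiv₀.symm.surjective γ
  -- A linear map `R → M` is determined by its value at 1.
  refine ⟨b, hb, g (1 : R), fun t ht => ?_⟩
  rw [← Abelian.Ext.mk₀_smul, Abelian.Ext.mk₀_comp_mk₀] at hγ
  erw [Abelian.Ext.mk₀_comp_mk₀] at hγ
  have h1 := ConcreteCategory.congr_hom (Abelian.Ext.addEquiv₀.symm.injective hγ) (⟨t, ht⟩ : ↥(J ^ b))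
  have h2 : g t = t • g (1 : R) := by
    rw [← g.hom.map_smul, smul_eq_mul, mul_one]
  exact h1.symm.trans h2

variable {M : Type u} [AddCommGroup M] [Module R M]

/-- The short complex `M ⟶ M ⟶ M ⧸ xⁿM`, the first map being multiplication by `xⁿ`. -/
noncomputable abbrev ModuleCat.powSMulShortComplex (M : Type u) [AddCommGroup M] [Module R M]
    (x : R) (n : ℕ) : ShortComplex (ModuleCat.{u} R) :=
  ShortComplex.mk (ModuleCat.ofHom (LinearMap.lsmul R M (x ^ n)))
    (ModuleCat.ofHom (Submodule.mkQ (Ideal.span {x} ^ n • ⊤ : Submodule R M))) (by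
      ext m
      exact (Submodule.Quotient.mk_eq_zero _).2 (Submodule.smul_mem_smul
        (Ideal.pow_mem_pow (Ideal.mem_span_singleton_self x) n) trivial))

lemma Submodule.mem_span_singleton_pow_smul_top {x : R} {n : ℕ} {m : M} :
    m ∈ (Ideal.span {x} ^ n • ⊤ : Submodule R M) ↔ ∃ m', x ^ n • m' = m := by
  rw [Ideal.span_singleton_pow, Submodule.ideal_span_singleton_smul]
  simp [Submodule.mem_smul_pointwise_iff_exists]

lemma ModuleCat.shortExact_powSMulShortComplex {x : R} (hx : IsSMulRegular M x) (n : ℕ) :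
    (ModuleCat.powSMulShortComplex M x n).ShortExact where
  exact := by
    rw [ShortComplex.moduleCat_exact_iff]
    intro m hm
    exact Submodule.mem_span_singleton_pow_smul_top.1 ((Submodule.Quotient.mk_eq_zero _).1 hm)
  mono_f := (ModuleCat.mono_iff_injective _).2 (hx.pow n)
  epi_g := (ModuleCat.epi_iff_surjective _).2 (Submodule.mkQ_surjective _)

/-- The projection `M ⧸ xⁿ⁺ᵏM → M ⧸ xⁿM`. -/
abbrev Submodule.powSMulProj (M : Type u) [AddCommGroup M] [Module R M] (x : R) (n k : ℕ) :
    (M ⧸ (Ideal.span {x} ^ (n + k) • ⊤ : Submodule R M)) →ₗ[R]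
      M ⧸ (Ideal.span {x} ^ n • ⊤ : Submodule R M) :=
  Submodule.mapQ _ _ LinearMap.id
    (Submodule.smul_mono_left (Ideal.pow_le_pow_right (Nat.le_add_right n k)))

/-- The maps `xᵏ`, identity and projection form a morphism from the sequence for `xⁿ⁺ᵏ` to the one
for `xⁿ`. -/
lemma ModuleCat.powSMulShortComplex_extClass_naturality {x : R} (hx : IsSMulRegular M x)
    (n k : ℕ) :
    x ^ k • (shortExact_powSMulShortComplex hx (n + k)).extClass =
    (Abelian.Ext.mk₀ (ModuleCat.ofHom (Submodule.powSMulProj M x n k))).comp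
      (shortExact_powSMulShortComplex hx n).extClass (zero_add 1) := by
  rw [Abelian.Ext.smul_eq_comp_mk₀]
  exact ShortComplex.ShortExact.extClass_naturality (shortExact_powSMulShortComplex hx (n + k))
    (shortExact_powSMulShortComplex hx n)
    { τ₁ := x ^ k • 𝟙 _, τ₂ := 𝟙 _, τ₃ := ModuleCat.ofHom (Submodule.powSMulProj M x n k)
      comm₁₂ := by ext m; simpa [pow_add, mul_smul] using smul_comm _ _ _ }

/-- The obstruction to lifting `φ` mod `xⁿ` is `xᵏ` times a class in `Ext¹(Jᵃ, M)`, and such a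
multiple vanishes on a smaller power of `J`. -/
lemma localCohomology.exists_lift_powSMulProj (J : Ideal R) {x : R} (hx : IsSMulRegular M x)
    (k : ℕ) (h : ∀ z : (localCohomology J 2).obj (ModuleCat.of R M), x ^ k • z = 0) (n a : ℕ)
    (φ : ↥(J ^ a) →ₗ[R] M ⧸ (Ideal.span {x} ^ (n + k) • ⊤ : Submodule R M)) :
    ∃ (b : ℕ) (hb : J ^ b ≤ J ^ a) (ψ : ↥(J ^ b) →ₗ[R] M), ∀ t (ht : t ∈ J ^ b),
      Submodule.Quotient.mk (ψ ⟨t, ht⟩) = Submodule.powSMulProj M x n k (φ ⟨t, hb ht⟩) := by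
  obtain ⟨b, hb, γ, hγ⟩ := exists_extend_smul_restrict J 1 (ModuleCat.of R M) (x ^ k) h a
    ((Abelian.Ext.mk₀ (ModuleCat.ofHom φ)).comp
      (ModuleCat.shortExact_powSMulShortComplex hx (n + k)).extClass (zero_add 1))
  -- `γ` lies in `Ext¹(R, M) = 0`, so `xᵏ` times the obstruction is zero on `Jᵇ`.
  rw [Abelian.Ext.eq_zero_of_projective γ, Abelian.Ext.comp_zero, ← Abelian.Ext.comp_smul,
    ModuleCat.powSMulShortComplex_extClass_naturality hx, Abelian.Ext.mk₀_comp_mk₀_assoc,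
    Abelian.Ext.mk₀_comp_mk₀_assoc] at hγ
  obtain ⟨ψ, hψ⟩ := Abelian.Ext.covariant_sequence_exact₃ _
    (ModuleCat.shortExact_powSMulShortComplex hx n) _ _ hγ.symm
  obtain ⟨ψ, rfl⟩ := Abelian.Ext.addEquiv₀.symm.surjective ψ
  erw [Abelian.Ext.mk₀_comp_mk₀] at hψ
  refine ⟨b, hb, ψ.hom, fun t ht => ?_⟩
  exact ConcreteCategory.congr_hom (Abelian.Ext.addEquiv₀.symm.injective hψ) (⟨t, ht⟩ : ↥(J ^ b))

end PowersHom

/-! ### Sections of the sheaf associated to a module: torsion and denominators. -/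

section Sections

open StructureSheaf

variable {R : Type u} [CommRing R] {M : Type u} [AddCommGroup M] [Module R M]
  {U : Opens (PrimeSpectrum R)}

/-- The sections over `U` of the sheaf associated to the module `M`. -/
abbrev ModuleSections (M : Type u) [AddCommGroup M] [Module R M]
    (U : Opens (PrimeSpectrum R)) : Type u :=
  (structureSheafInType R M).1.obj (op (U : Opens (PrimeSpectrum.Top R)))

lemma ModuleSections.ext {s t : ModuleSections M U} (h : ∀ p : U, s.1 p = t.1 p) : s = t :=
  Subtype.ext (funext h)

lemma LocalizedModule.smul_injective_of_mem {S : Submonoid R} {r : R} (hr : r ∈ S) :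
    Function.Injective (fun m : LocalizedModule S M => r • m) :=
  (IsLocalizedModule.smul_injective (LocalizedModule.mkLinearMap S M) ⟨r, hr⟩)

lemma LocalizedModule.smul_surjective_of_mem {S : Submonoid R} {r : R} (hr : r ∈ S)
    (m : LocalizedModule S M) : ∃ m', r • m' = m := by
  induction m using LocalizedModule.induction_on with
  | h m s =>
    refine ⟨LocalizedModule.mk m (⟨r, hr⟩ * s), ?_⟩
    rw [LocalizedModule.smul'_mk]
    exact LocalizedModule.mk_cancel_common_left ⟨r, hr⟩ s m

lemma LocalizedModule.isSMulRegular (S : Submonoid R) {x : R} (hx : IsSMulRegular M x) :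
    IsSMulRegular (LocalizedModule S M) x := by
  intro m m' h
  induction m, m' using LocalizedModule.induction_on₂ with
  | h m m' s s' =>
    simp only [LocalizedModule.smul'_mk] at h
    obtain ⟨u, hu⟩ := LocalizedModule.mk_eq.1 h
    refine LocalizedModule.mk_eq.2 ⟨u, hx ?_⟩
    simpa only [smul_comm x] using hu

lemma ModuleSections.eq_of_smul_eq {I : Ideal R} (hU : ∀ p ∈ U, ¬ I ≤ p.asIdeal)
    {s t : ModuleSections M U} (h : ∀ r ∈ I, r • s = r • t) : s = t := by
  refine ext fun p => ?_
  obtain ⟨r, hr, hrp⟩ := SetLike.not_le_iff_exists.1 (hU p.1 p.2)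
  exact LocalizedModule.smul_injective_of_mem (S := p.1.asIdeal.primeCompl) hrp
    (congrFun (congrArg Subtype.val (h r hr)) p)

lemma ModuleSections.smul_injective {x : R} (hx : IsSMulRegular M x) {s t : ModuleSections M U}
    (h : x • s = x • t) : s = t := by
  refine ext fun p => ?_
  have h1 : x • s.1 p = x • t.1 p := congrFun (congrArg Subtype.val h) p
  exact LocalizedModule.isSMulRegular p.1.asIdeal.primeCompl hx h1

/-- A section vanishing on `D(f)` is killed by a power of `f`. -/
lemma ModuleSections.exists_pow_smul_eq_zero (hU : IsCompact (U : Set (PrimeSpectrum R)))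
    (f : R) (s : ModuleSections M U) (hs : ∀ p : U, f ∉ p.1.asIdeal → s.1 p = 0) :
    ∃ e : ℕ, f ^ e • s = 0 := by
  have key : ∀ p : U, ∃ (V : Set (PrimeSpectrum R)) (_ : IsOpen V) (_ : p.1 ∈ V) (e : ℕ),
      ∀ q : U, q.1 ∈ V → f ^ e • s.1 q = 0 := by
    intro p
    obtain ⟨g, hpg, hgU, m, hm⟩ := exists_const U s p.1 p.2
    have hm' : ∀ q : U, ∀ hq : g ∉ q.1.asIdeal, s.1 q = LocalizedModule.mk m ⟨g, hq⟩ :=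
      fun q hq => (congrFun (congrArg Subtype.val hm) ⟨q.1, hq⟩).symm
    -- If `s = m/g` on `D(g)`, then `m` vanishes on `D(fg)`, so a power of `fg` kills `m`; as `g` is
    -- invertible on `D(g)`, that power of `f` kills `s` there.
    have h0 : toOpenₗ R M (PrimeSpectrum.basicOpen (f * g)) m = 0 := by
      refine ext fun q => ?_
      obtain ⟨hqf, hqg⟩ := (PrimeSpectrum.basicOpen_mul f g).le q.2
      have := (hm' ⟨q.1, hgU hqg⟩ hqg).symm.trans (hs _ hqf)
      have h2 : g • LocalizedModule.mk (S := q.1.asIdeal.primeCompl) m ⟨g, hqg⟩ = 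
        LocalizedModule.mk m 1 := by 
        rw [LocalizedModule.smul'_mk]
        exact LocalizedModule.mk_cancel ⟨g, hqg⟩ m
      rw [this, smul_zero] at h2
      exact h2.symm
    obtain ⟨⟨_, e, rfl⟩, he⟩ := (IsLocalizedModule.eq_zero_iff (Submonoid.powers (f * g))
      (toOpenₗ R M (PrimeSpectrum.basicOpen (f * g)))).1 h0
    refine ⟨PrimeSpectrum.basicOpen g, (PrimeSpectrum.basicOpen g).2, hpg, e, fun q hq => ?_⟩
    rw [hm' q hq, LocalizedModule.smul'_mk]
    have he' : (f * g) ^ e • m = 0 := he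
    refine (LocalizedModule.mk_eq.2 ⟨⟨g ^ e, q.1.asIdeal.primeCompl.pow_mem hq e⟩, ?_⟩).trans
      (LocalizedModule.zero_mk ⟨g, hq⟩)
    simp only [Submonoid.smul_def, smul_zero]
    rw [smul_comm g, smul_comm (g ^ e), ← mul_smul (f ^ e), ← mul_pow, smul_comm _ g, he', smul_zero]
  choose V hV hpV e he using key
  obtain ⟨t, ht⟩ := hU.elim_finite_subcover V hV fun p hp => Set.mem_iUnion.2 ⟨⟨p, hp⟩, hpV _⟩
  refine ⟨t.sup e, ext fun q => ?_⟩
  obtain ⟨p, hp, hq⟩ := Set.mem_iUnion₂.1 (ht q.2)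
  refine (?_ : f ^ t.sup e • s.1 q = 0)
  rw [← Nat.sub_add_cancel (Finset.le_sup hp : e p ≤ t.sup e), pow_add, mul_smul, he p q hq,
    smul_zero]

/-- Sections over `D(f)` form the localization `M_f`; after clearing the denominator, the
discrepancy over `U` vanishes on `D(f)` and is killed by a further power of `f`. -/
lemma ModuleSections.exists_pow_smul_eq_toOpen (hU : IsCompact (U : Set (PrimeSpectrum R)))
    (f : R) (hf : PrimeSpectrum.basicOpen f ≤ U) (s : ModuleSections M U) :
    ∃ (e : ℕ) (m : M), f ^ e • s = toOpenₗ R M U m := by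
  let s' : ModuleSections M (PrimeSpectrum.basicOpen f) :=
    (structureSheafInType R M).1.map (homOfLE hf).op s
  obtain ⟨⟨m, ⟨_, e, rfl⟩⟩, hm⟩ := IsLocalizedModule.surj (Submonoid.powers f)
    (toOpenₗ R M (PrimeSpectrum.basicOpen f)) s'
  have hm' : f ^ e • s' = toOpenₗ R M (PrimeSpectrum.basicOpen f) m := hm
  obtain ⟨e', he'⟩ := exists_pow_smul_eq_zero hU f (f ^ e • s - toOpenₗ R M U m) (by
    intro p hp
    exact sub_eq_zero.2 (congrFun (congrArg Subtype.val hm') ⟨p.1, hp⟩))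
  refine ⟨e' + e, f ^ e' • m, ?_⟩
  rw [smul_sub, sub_eq_zero] at he'
  rw [pow_add, mul_smul, he', map_smul]

end Sections

/-! ### Deligne's formula and division of sections by a regular element. -/

section Sections

open StructureSheaf

variable {R : Type u} [CommRing R] {M : Type u} [AddCommGroup M] [Module R M]
  {U : Opens (PrimeSpectrum R)}

lemma toOpenₗ_eq_zero {f : R} (hf : PrimeSpectrum.basicOpen f ≤ U) {m : M}
    (hm : toOpenₗ R M U m = 0) : ∃ e : ℕ, f ^ e • m = 0 := by
  have h0 : toOpenₗ R M (PrimeSpectrum.basicOpen f) m = 0 :=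
    ModuleSections.ext fun p => congrFun (congrArg Subtype.val hm) ⟨p.1, hf p.2⟩
  obtain ⟨⟨_, e, rfl⟩, he⟩ := (IsLocalizedModule.eq_zero_iff (Submonoid.powers f)
    (toOpenₗ R M (PrimeSpectrum.basicOpen f))).1 h0
  exact ⟨e, he⟩

lemma Submodule.exists_pow_smul_eq_bot [IsNoetherianRing R] (J : Ideal R) (K : Submodule R M)
    (hK : K.FG) (h : ∀ f ∈ J, ∀ m ∈ K, ∃ e : ℕ, f ^ e • m = 0) :
    ∃ e : ℕ, J ^ e • K = ⊥ := by
  have h1 : ∀ m ∈ K, ∃ e : ℕ, ∀ r ∈ J ^ e, r • m = 0 := by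
    intro m hm
    obtain ⟨e, he⟩ := Ideal.exists_pow_le_of_le_radical_of_fg
      (J := LinearMap.ker (LinearMap.toSpanSingleton R M m)) (I := J)
      (fun f hf => (h f hf m hm)) (IsNoetherian.noetherian _)
    exact ⟨e, fun r hr => he hr⟩
  obtain ⟨S, rfl⟩ := hK
  choose! e he using h1
  refine ⟨S.sup e, le_bot_iff.1 (Submodule.smul_le.2 fun r hr m hm => (Submodule.mem_bot R).2 ?_)⟩
  induction hm using Submodule.span_induction with
  | mem m hm =>
    exact he m (Submodule.subset_span hm) r (Ideal.pow_le_pow_right (Finset.le_sup hm) hr)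
  | zero => exact smul_zero r
  | add m m' _ _ h h' => rw [smul_add, h, h', add_zero]
  | smul c m _ h => rw [smul_comm, h, smul_zero]

variable {J : Ideal R}

/-- Deligne's formula: over the complement `U` of `V(J)` every section of the sheaf associated to
a finite module comes from a linear map `Jᵃ → M`. -/
lemma ModuleSections.exists_linearMap [IsNoetherianRing R] [Module.Finite R M]
    (hU : IsCompact (U : Set (PrimeSpectrum R)))
    (hJ : ∀ f ∈ J, PrimeSpectrum.basicOpen f ≤ U) (s : ModuleSections M U) :
    ∃ (a : ℕ) (φ : ↥(J ^ a) →ₗ[R] M), ∀ r : ↥(J ^ a), r.1 • s = toOpenₗ R M U (φ r) := by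
  -- `T` is the graph-like module of pairs `(r, m)` with `r • s = m` over `U`. The linear map sought
  -- is the inverse of the first projection `π` followed by the second, once `π` is made injective.
  let T : Submodule R (R × M) := LinearMap.ker
    ((LinearMap.toSpanSingleton R (ModuleSections M U) s).comp (LinearMap.fst R R M) -
      (toOpenₗ R M U).comp (LinearMap.snd R R M))
  have hT : ∀ {q : R × M}, q ∈ T ↔ q.1 • s = toOpenₗ R M U q.2 := fun {q} => sub_eq_zero
  let π : T →ₗ[R] R := (LinearMap.fst R R M).comp T.subtype
  obtain ⟨a, ha⟩ : ∃ a, J ^ a ≤ LinearMap.range π := by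
    refine Ideal.exists_pow_le_of_le_radical_of_fg (fun f hf => ?_) (IsNoetherian.noetherian _)
    obtain ⟨e, m, hm⟩ := exists_pow_smul_eq_toOpen hU f (hJ f hf) s
    exact ⟨e, ⟨⟨(f ^ e, m), hT.2 hm⟩, rfl⟩⟩
  obtain ⟨e, he⟩ := Submodule.exists_pow_smul_eq_bot J (LinearMap.ker π)
    (IsNoetherian.noetherian _) (by
      rintro f hf ⟨⟨r, m⟩, hq⟩ (rfl : r = 0)
      obtain ⟨e, he⟩ := toOpenₗ_eq_zero (hJ f hf) ((hT.1 hq).symm.trans (zero_smul R s))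
      exact ⟨e, Subtype.ext (Prod.ext (smul_zero _) he)⟩)
  -- Artin–Rees: `Jᵉ⁺ᶜT ∩ ker π ⊆ Jᵉ ker π = 0`, so `π` is injective on `Jᵉ⁺ᶜT`, whose image still
  -- contains `Jᵉ⁺ᶜ⁺ᵃ`.
  obtain ⟨c, hc⟩ := J.exists_pow_inf_eq_pow_smul (LinearMap.ker π)
  let T' : Submodule R T := J ^ (e + c) • ⊤
  have hinj : Function.Injective (π.comp T'.subtype) := by
    refine (injective_iff_map_eq_zero _).2 fun q hq => ?_
    have h1 : q.1 ∈ T' ⊓ LinearMap.ker π := ⟨q.2, hq⟩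
    rw [hc (e + c) (Nat.le_add_left _ _), Nat.add_sub_cancel] at h1
    have h2 := Submodule.smul_mono (le_refl (J ^ e)) (inf_le_right : J ^ c • ⊤ ⊓ LinearMap.ker π ≤ _) h1
    rw [he] at h2
    exact Subtype.ext h2
  have hrange : J ^ (e + c + a) ≤ LinearMap.range (π.comp T'.subtype) := by
    rw [LinearMap.range_comp, Submodule.range_subtype, Submodule.map_smul'', Submodule.map_top,
      pow_add]
    exact Submodule.smul_mono le_rfl ha
  refine ⟨e + c + a, ((LinearMap.snd R R M).comp (T.subtype.comp T'.subtype)).comp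
    ((LinearEquiv.ofInjective _ hinj).symm.toLinearMap.comp (Submodule.inclusion hrange)),
    fun r => ?_⟩
  obtain ⟨q, hq⟩ := (LinearEquiv.ofInjective _ hinj).surjective (Submodule.inclusion hrange r)
  have h1 : q.1.1.1 = r.1 := congrArg Subtype.val hq
  have h2 := hT.1 q.1.2
  rw [h1] at h2
  rw [h2]
  simp [← hq]

/-- The value at `p` is `φ(r)/r` for any `r ∈ J` outside `p`; the choice is immaterial because `c
φ(d) = φ(cd) = d φ(c)`. -/
lemma ModuleSections.exists_of_linearMap (hU : ∀ p ∈ U, ¬ J ≤ p.asIdeal) (φ : ↥J →ₗ[R] M) :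
    ∃ s : ModuleSections M U, ∀ r : J, r.1 • s = toOpenₗ R M U (φ r) := by
  have h1 : ∀ p : U, ∃ r : J, r.1 ∉ p.1.asIdeal := fun p => by
    obtain ⟨r, hr, hp⟩ := SetLike.not_le_iff_exists.1 (hU p.1 p.2)
    exact ⟨⟨r, hr⟩, hp⟩
  choose r hr using h1
  have key : ∀ (p : U) (c d : J) (hc : c.1 ∉ p.1.asIdeal) (hd : d.1 ∉ p.1.asIdeal),
      LocalizedModule.mk (S := p.1.asIdeal.primeCompl) (φ c) ⟨c.1, hc⟩ =
        LocalizedModule.mk (φ d) ⟨d.1, hd⟩ := fun p c d hc hd => by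
    refine LocalizedModule.mk_eq.2 ⟨1, ?_⟩
    simp only [Submonoid.smul_def, one_smul, ← map_smul]
    exact congrArg φ (Subtype.ext (mul_comm _ _))
  refine ⟨⟨fun p => LocalizedModule.mk (φ (r p)) ⟨(r p).1, hr p⟩, fun p => ?_⟩, fun c => ?_⟩
  · exact ⟨U ⊓ PrimeSpectrum.basicOpen (r p).1, ⟨p.2, hr p⟩, Opens.infLELeft _ _, φ (r p), (r p).1,
      fun q => ⟨q.2.2, key ⟨q.1, q.2.1⟩ _ _ _ _⟩⟩
  · refine ext fun p => ?_
    refine (LocalizedModule.smul'_mk _ _ _).trans ?_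
    refine LocalizedModule.mk_eq.2 ⟨1, ?_⟩
    simp only [Submonoid.smul_def, one_smul, ← map_smul]
    exact congrArg φ (Subtype.ext (mul_comm _ _))

/-- A section divisible by the nonzerodivisor `x` in every stalk is divisible by `x`. -/
lemma ModuleSections.exists_smul_eq {x : R} (hx : IsSMulRegular M x) (s : ModuleSections M U)
    (h : ∀ p : U, ∃ m : LocalizedModule p.1.asIdeal.primeCompl M, x • m = s.1 p) :
    ∃ t : ModuleSections M U, x • t = s := by
  choose t ht using h
  refine ⟨⟨t, fun p => ?_⟩, ext ht⟩
  obtain ⟨g, hpg, hgU, m, hm⟩ := exists_const U s p.1 p.2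
  have hm' : ∀ q : U, ∀ hq : g ∉ q.1.asIdeal, s.1 q = LocalizedModule.mk m ⟨g, hq⟩ :=
    fun q hq => (congrFun (congrArg Subtype.val hm) ⟨q.1, hq⟩).symm
  obtain ⟨m', ⟨d, hd⟩, htp⟩ : ∃ m' d, t p = LocalizedModule.mk m' d := by
    induction t p using LocalizedModule.induction_on with
    | h m s => exact ⟨m, s, rfl⟩
  have h1 := ht p
  rw [htp, hm' p hpg, LocalizedModule.smul'_mk] at h1
  obtain ⟨⟨c, hcp⟩, hc⟩ := LocalizedModule.mk_eq.1 h1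
  -- The equation `x m'/d = m/g` at `p` is witnessed by `c`, so it holds wherever `c`, `d`, `g` are
  -- invertible; cancelling `x` there gives `t = m'/d`.
  refine ⟨U ⊓ (PrimeSpectrum.basicOpen c ⊓ (PrimeSpectrum.basicOpen d ⊓ PrimeSpectrum.basicOpen g)),
    ⟨p.2, hcp, hd, hpg⟩, Opens.infLELeft _ _, m', d, fun q => ⟨q.2.2.2.1, ?_⟩⟩
  refine LocalizedModule.isSMulRegular _ hx ?_
  refine (ht ⟨q.1, q.2.1⟩).trans ((hm' ⟨q.1, q.2.1⟩ q.2.2.2.2).trans (Eq.symm ?_))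
  exact (LocalizedModule.smul'_mk _ _ _).trans (LocalizedModule.mk_eq.2 ⟨⟨c, q.2.2.1⟩, hc⟩)

end Sections

/-! ### Reducing formal sections modulo powers of `x`. -/

section Completion

open StructureSheaf

variable {R : Type u} [CommRing R] {M : Type u} [AddCommGroup M] [Module R M] {x : R} {n : ℕ}

lemma LocalizedModule.mem_map_span_pow_smul_top {p : PrimeSpectrum R}
    {μ : LocalizedModule p.asIdeal.primeCompl M} :
    μ ∈ ((Ideal.span {x}).map (algebraMap R (Localization p.asIdeal.primeCompl)) ^ n • ⊤ :
      Submodule (Localization p.asIdeal.primeCompl) (LocalizedModule p.asIdeal.primeCompl M)) ↔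
      ∃ μ', x ^ n • μ' = μ := by
  rw [Ideal.map_span, Set.image_singleton, Submodule.mem_span_singleton_pow_smul_top]
  simp only [← map_pow, algebraMap_smul]

/-- Exactness of localization. It identifies `M_p/xⁿM_p`, used in the completion, with the stalk of
the sheaf of `M/xⁿM`. -/
lemma LocalizedModule.map_mkQ_eq_zero_iff {p : PrimeSpectrum R}
    {μ : LocalizedModule p.asIdeal.primeCompl M} :
    LocalizedModule.map p.asIdeal.primeCompl
      (Submodule.mkQ (Ideal.span {x} ^ n • ⊤ : Submodule R M)) μ = 0 ↔ ∃ μ', x ^ n • μ' = μ := by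
  induction μ using LocalizedModule.induction_on with
  | h m f =>
    constructor
    · intro h
      rw [LocalizedModule.map_mk] at h
      obtain ⟨c, hc⟩ := LocalizedModule.mk_eq.1 (h.trans (LocalizedModule.zero_mk 1).symm)
      simp only [one_smul, smul_zero] at hc
      obtain ⟨m', hm'⟩ := Submodule.mem_span_singleton_pow_smul_top.1
        ((Submodule.Quotient.mk_eq_zero _).1 (show Submodule.Quotient.mk (c.1 • m) = 0 from hc))
      refine ⟨LocalizedModule.mk m' (c * f), ?_⟩
      rw [LocalizedModule.smul'_mk, hm']
      exact LocalizedModule.mk_cancel_common_left c f m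
    · rintro ⟨μ', hμ'⟩
      rw [← hμ']
      induction μ' using LocalizedModule.induction_on with
      | h m' f' =>
        rw [LocalizedModule.smul'_mk, LocalizedModule.map_mk, map_smul, Submodule.mkQ_apply,
          ← Submodule.Quotient.mk_smul, (Submodule.Quotient.mk_eq_zero _).2
          (Submodule.mem_span_singleton_pow_smul_top.2 ⟨m', rfl⟩), LocalizedModule.zero_mk]

lemma LocalizedModule.map_mkQ_eq_of_mk_eq {p : PrimeSpectrum R}
    {μ μ' : LocalizedModule p.asIdeal.primeCompl M}
    (h : (Submodule.Quotient.mk μ : _ ⧸ ((Ideal.span {x}).map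
      (algebraMap R (Localization p.asIdeal.primeCompl)) ^ n • ⊤ :
      Submodule (Localization p.asIdeal.primeCompl) (LocalizedModule p.asIdeal.primeCompl M))) =
        Submodule.Quotient.mk μ') :
    LocalizedModule.map p.asIdeal.primeCompl
      (Submodule.mkQ (Ideal.span {x} ^ n • ⊤ : Submodule R M)) μ =
    LocalizedModule.map p.asIdeal.primeCompl (Submodule.mkQ _) μ' := by
  rw [← sub_eq_zero, ← map_sub, LocalizedModule.map_mkQ_eq_zero_iff,
    ← LocalizedModule.mem_map_span_pow_smul_top, ← Submodule.Quotient.eq]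
  exact h

variable [IsLocalRing R]

/-- The punctured spectrum as an open subset of the prime spectrum. -/
abbrev puncturedOpens (R : Type u) [CommRing R] [IsLocalRing R] : Opens (PrimeSpectrum R) :=
  FormalGeometry.puncturedSpectrum R

lemma not_maximalIdeal_le_of_mem_puncturedSpectrum {p : PrimeSpectrum R}
    (hp : p ∈ puncturedOpens R) :
    ¬ maximalIdeal R ≤ p.asIdeal := fun h => hp <| PrimeSpectrum.ext
  ((maximalIdeal.isMaximal R).eq_of_le p.2.ne_top h).symm

lemma basicOpen_le_puncturedSpectrum {f : R} (hf : f ∈ maximalIdeal R) :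
    PrimeSpectrum.basicOpen f ≤ puncturedOpens R := by
  rintro p hp rfl
  exact hp hf

lemma mem_puncturedLocus {p : PrimeSpectrum R} (hp : x ∈ p.asIdeal) (h : p ∈ puncturedOpens R) :
    p ∈ FormalGeometry.puncturedLocus (Ideal.span {x}) :=
  ⟨(Ideal.span_singleton_le_iff_mem _).2 hp, h⟩

lemma isCompact_puncturedSpectrum [IsNoetherianRing R] :
    IsCompact (puncturedOpens R :
      Set (PrimeSpectrum R)) :=
  TopologicalSpace.NoetherianSpace.isCompact _

/-- The value of a section over the punctured spectrum at a point of `Y`. -/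
def ModuleSections.germ {a : Ideal R} (s : ModuleSections M (puncturedOpens R))
    (y : FormalGeometry.puncturedLocusTop a) :
    LocalizedModule (FormalGeometry.toSpec y).asIdeal.primeCompl M :=
  s.1 ⟨FormalGeometry.toSpec y, y.2.2⟩

/-- A section of `F̂` modulo `xⁿ` is a section over the punctured spectrum of the sheaf associated
to `M ⧸ xⁿM`. -/
lemma exists_section_quotient
    (σ : FormalGeometry.completionSections (Ideal.span {x}) M ⊤) (n : ℕ) :
    ∃ s : ModuleSections (M ⧸ (Ideal.span {x} ^ n • ⊤ : Submodule R M))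
        (puncturedOpens R),
      ∀ (y : FormalGeometry.puncturedLocusTop (Ideal.span {x}))
        (μ : LocalizedModule (FormalGeometry.toSpec y).asIdeal.primeCompl M),
        (σ.1 ⟨y, trivial⟩).val n = Submodule.Quotient.mk μ →
          s.germ y = LocalizedModule.map _ (Submodule.mkQ _) μ := by
  -- Away from `V(x)` the stalks of the sheaf of `M/xⁿM` vanish, so a section given along `Y`
  -- extends by zero to `X`.
  have h0 : ∀ (p : PrimeSpectrum R), x ∉ p.asIdeal → ∀ q q' : LocalizedModule p.asIdeal.primeCompl
      (M ⧸ (Ideal.span {x} ^ n • ⊤ : Submodule R M)), q = q' := by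
    have : ∀ (p : PrimeSpectrum R), x ∉ p.asIdeal → ∀ q : LocalizedModule p.asIdeal.primeCompl
      (M ⧸ (Ideal.span {x} ^ n • ⊤ : Submodule R M)), q = 0 := by
      intro p hp q
      induction q using LocalizedModule.induction_on with
      | h q f =>
        obtain ⟨m, rfl⟩ := Submodule.mkQ_surjective _ q
        rw [← LocalizedModule.map_mk]
        exact LocalizedModule.map_mkQ_eq_zero_iff.2
          (LocalizedModule.smul_surjective_of_mem (p.asIdeal.primeCompl.pow_mem hp n) _)
    exact fun p hp q q' => (this p hp q).trans (this p hp q').symm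
  choose lift hlift using fun y : FormalGeometry.puncturedLocusTop (Ideal.span {x}) =>
    Submodule.Quotient.mk_surjective _ ((σ.1 ⟨y, trivial⟩).val n)
  let q (y : FormalGeometry.puncturedLocusTop (Ideal.span {x})) :
      LocalizedModule (FormalGeometry.toSpec y).asIdeal.primeCompl
        (M ⧸ (Ideal.span {x} ^ n • ⊤ : Submodule R M)) :=
    LocalizedModule.map _ (Submodule.mkQ _) (lift y)
  let s (p : puncturedOpens R) : LocalizedModule p.1.asIdeal.primeCompl
      (M ⧸ (Ideal.span {x} ^ n • ⊤ : Submodule R M)) := by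
    classical
    exact if h : p.1 ∈ FormalGeometry.puncturedLocus (Ideal.span {x}) then q ⟨p.1, h⟩ else 0
  have hs : ∀ (y : FormalGeometry.puncturedLocusTop (Ideal.span {x}))
      (μ : LocalizedModule (FormalGeometry.toSpec y).asIdeal.primeCompl M),
      (σ.1 ⟨y, trivial⟩).val n = Submodule.Quotient.mk μ →
      s ⟨FormalGeometry.toSpec y, y.2.2⟩ = LocalizedModule.map _ (Submodule.mkQ _) μ :=
    fun y μ hμ => (dif_pos y.2).trans
      (LocalizedModule.map_mkQ_eq_of_mk_eq ((hlift y).trans hμ))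
  refine ⟨⟨s, fun p => ?_⟩, hs⟩
  by_cases hp : x ∈ p.1.asIdeal
  · have hpY : p.1 ∈ FormalGeometry.puncturedLocus (Ideal.span {x}) :=
      mem_puncturedLocus hp p.2
    obtain ⟨V, hxV, i, m, f, w⟩ := σ.2 n ⟨⟨p.1, hpY⟩, trivial⟩
    -- The fraction is known only on an open subset of `Y`; it remains valid on an open `W` of `Spec
    -- R` with that trace, since off `Y` there is nothing to check.
    obtain ⟨W, hW, hWV⟩ := isOpen_induced_iff.1 V.2
    have hmem : ∀ y : FormalGeometry.puncturedLocusTop (Ideal.span {x}),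
        FormalGeometry.toSpec y ∈ W → y ∈ V := fun y hy =>
      (Set.ext_iff.1 hWV y).1 hy
    have hpW : p.1 ∈ W := (Set.ext_iff.1 hWV ⟨p.1, hpY⟩).2 hxV
    refine ⟨puncturedOpens R ⊓ (⟨W, hW⟩ ⊓ PrimeSpectrum.basicOpen f),
      ⟨p.2, hpW, (w ⟨_, hxV⟩).1⟩, Opens.infLELeft _ _, Submodule.mkQ _ m, f,
      fun q => ⟨q.2.2.2, ?_⟩⟩
    by_cases hq : x ∈ (show PrimeSpectrum R from q.1).asIdeal
    · have hqY : q.1 ∈ FormalGeometry.puncturedLocus (Ideal.span {x}) :=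
        mem_puncturedLocus hq q.2.1
      obtain ⟨hf, e⟩ := w ⟨⟨q.1, hqY⟩, hmem _ q.2.2.1⟩
      exact (hs ⟨q.1, hqY⟩ _ e).trans (LocalizedModule.map_mk _ _ _ _)
    · exact h0 _ hq _ _
  · exact ⟨puncturedOpens R ⊓ PrimeSpectrum.basicOpen x, ⟨p.2, hp⟩,
      Opens.infLELeft _ _, 0, x, fun q => ⟨q.2.2, h0 _ q.2.2 _ _⟩⟩

end Completion

/-! ### Comparison of sections over `X` with formal sections. -/

section Comparison

open StructureSheaf FormalGeometry

variable {R : Type u} [CommRing R] {M : Type u} [AddCommGroup M] [Module R M] {x : R}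

lemma AdicCompletion.val_eq_mk_of_le {A N : Type*} [CommRing A] {I : Ideal A} [AddCommGroup N]
    [Module A N] {z : AdicCompletion I N} {m n : ℕ} (h : m ≤ n) {ν : N}
    (hν : z.val n = Submodule.Quotient.mk ν) : z.val m = Submodule.Quotient.mk ν := by
  rw [← z.2 h, hν]
  rfl

/-- As `r` is invertible at `p`, the congruence `μ ≡ τ` mod `xⁿ` may be tested after multiplying by
`r`, where both sides reduce to elements of `M`. -/
lemma LocalizedModule.mk_eq_mk_of_smul {p : PrimeSpectrum R} {n k : ℕ}
    {μ τ : LocalizedModule p.asIdeal.primeCompl M} {r : R} (hr : r ∉ p.asIdeal) {m₀ m : M}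
    (hμ : r • LocalizedModule.map p.asIdeal.primeCompl
      (Submodule.mkQ (Ideal.span {x} ^ (n + k) • ⊤ : Submodule R M)) μ =
        LocalizedModule.mk (Submodule.mkQ _ m₀) 1)
    (hτ : r • τ = LocalizedModule.mk m 1) (hm : ∃ m₁, x ^ n • m₁ = m - m₀) :
    (Submodule.Quotient.mk μ : _ ⧸ ((Ideal.span {x}).map
      (algebraMap R (Localization p.asIdeal.primeCompl)) ^ n • ⊤ :
      Submodule (Localization p.asIdeal.primeCompl) (LocalizedModule p.asIdeal.primeCompl M))) =
        Submodule.Quotient.mk τ := by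
  obtain ⟨m₁, hm₁⟩ := hm
  obtain ⟨μ₁, hμ₁⟩ : ∃ μ₁, x ^ (n + k) • μ₁ = r • μ - LocalizedModule.mk m₀ 1 := by
    rw [← LocalizedModule.map_mkQ_eq_zero_iff, map_sub, LocalizedModule.map_mk, ← hμ, sub_eq_zero]
    exact LinearMap.map_smul_of_tower _ r μ
  obtain ⟨ν, hν⟩ := LocalizedModule.smul_surjective_of_mem (S := p.asIdeal.primeCompl) hr
    (LocalizedModule.mk m₁ 1 - x ^ k • μ₁)
  have e₃ : τ - μ = x ^ n • ν := by
    refine LocalizedModule.smul_injective_of_mem (S := p.asIdeal.primeCompl) hr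
      (?_ : r • (τ - μ) = r • (x ^ n • ν))
    have e₄ : LocalizedModule.mk (S := p.asIdeal.primeCompl) m 1 =
        LocalizedModule.mk m₀ 1 + x ^ n • LocalizedModule.mk m₁ 1 := by
      rw [LocalizedModule.smul'_mk, hm₁]
      simp only [← LocalizedModule.mkLinearMap_apply, map_sub]
      abel
    rw [smul_comm, hν, smul_sub, hτ, e₄, smul_sub, ← mul_smul, ← pow_add, hμ₁]
    abel
  exact ((Submodule.Quotient.eq _).2
    (LocalizedModule.mem_map_span_pow_smul_top.2 ⟨ν, e₃.symm⟩)).symm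

variable [IsLocalRing R]

set_option maxHeartbeats 800000 in
lemma exists_section_germ_eq_mk [IsNoetherianRing R] [Module.Finite R M] (hx : IsSMulRegular M x)
    (k : ℕ) (h : ∀ z : (localCohomology (maximalIdeal R) 2).obj (ModuleCat.of R M), x ^ k • z = 0)
    (σ : completionSections (Ideal.span {x}) M ⊤) (n : ℕ) :
    ∃ t : ModuleSections M (puncturedOpens R), ∀ y : puncturedLocusTop (Ideal.span {x}),
      (σ.1 ⟨y, trivial⟩).val n = Submodule.Quotient.mk (t.germ y) := by
  -- Lifting loses `k` powers of `x`, hence the start at level `n + k`.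
  obtain ⟨s, hs⟩ := exists_section_quotient σ (n + k)
  obtain ⟨a, φ, hφ⟩ := s.exists_linearMap (J := maximalIdeal R) isCompact_puncturedSpectrum
    (fun f => basicOpen_le_puncturedSpectrum)
  have H := localCohomology.exists_lift_powSMulProj (maximalIdeal R) hx k h n a φ
  obtain ⟨b, hb, ψ, hψ⟩ := H
  have hU : ∀ p ∈ puncturedOpens R, ¬ maximalIdeal R ^ b ≤ p.asIdeal := fun p hp hle =>
    not_maximalIdeal_le_of_mem_puncturedSpectrum hp (p.2.le_of_pow_le hle)
  obtain ⟨t, ht⟩ := ModuleSections.exists_of_linearMap hU ψ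
  refine ⟨t, fun y => ?_⟩
  obtain ⟨r, hr, hry⟩ := SetLike.not_le_iff_exists.1 (hU (toSpec y) y.2.2)
  obtain ⟨μ, hμ⟩ := Submodule.Quotient.mk_surjective _ ((σ.1 ⟨y, trivial⟩).val (n + k))
  obtain ⟨m₀, hm₀⟩ := Submodule.mkQ_surjective _ (φ ⟨r, hb hr⟩)
  have e₁ : r • t.germ y = LocalizedModule.mk (ψ ⟨r, hr⟩) 1 :=
    congrFun (congrArg Subtype.val (ht ⟨r, hr⟩)) ⟨toSpec y, y.2.2⟩
  have e₂ : r • s.germ y = LocalizedModule.mk (φ ⟨r, hb hr⟩) 1 :=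
    congrFun (congrArg Subtype.val (hφ ⟨r, hb hr⟩)) ⟨toSpec y, y.2.2⟩
  refine (AdicCompletion.val_eq_mk_of_le (Nat.le_add_right n k) hμ.symm).trans ?_
  refine LocalizedModule.mk_eq_mk_of_smul hry (k := k) (m₀ := m₀) ?_ e₁ ?_
  · rw [← hs y μ hμ.symm, e₂, hm₀]
  · rw [← Submodule.mem_span_singleton_pow_smul_top, ← Submodule.Quotient.eq, hψ r hr, ← hm₀]
    rfl

lemma exists_pow_smul_eq_toOpenₗ [IsNoetherianRing R] [Module.Finite R M] (r : R)
    (h : ∀ z : (localCohomology (maximalIdeal R) 1).obj (ModuleCat.of R M), r • z = 0)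
    (s : ModuleSections M (puncturedOpens R)) : ∃ m : M, r • s = toOpenₗ R M (puncturedOpens R) m := by
  obtain ⟨a, φ, hφ⟩ := s.exists_linearMap (J := maximalIdeal R) isCompact_puncturedSpectrum
    (fun f => basicOpen_le_puncturedSpectrum)
  obtain ⟨b, hb, m, hm⟩ := localCohomology.exists_smul_eq_smul (maximalIdeal R) M r h a φ
  refine ⟨m, ModuleSections.eq_of_smul_eq (I := maximalIdeal R ^ b) (fun p hp hle =>
    not_maximalIdeal_le_of_mem_puncturedSpectrum hp (p.2.le_of_pow_le hle)) fun t ht => ?_⟩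
  rw [smul_comm, hφ ⟨t, hb ht⟩, ← (toOpenₗ R M (puncturedOpens R)).map_smul r, hm t ht, map_smul]

lemma ModuleSections.exists_pow_smul_eq_of_germ (hx : IsSMulRegular M x) {n : ℕ}
    (s : ModuleSections M (puncturedOpens R))
    (h : ∀ y : puncturedLocusTop (Ideal.span {x}), ∃ μ, x ^ n • μ = s.germ y) :
    ∃ t : ModuleSections M (puncturedOpens R), x ^ n • t = s := by
  refine exists_smul_eq (hx.pow n) s fun p => ?_
  by_cases hp : x ∈ p.1.asIdeal
  · exact h ⟨p.1, mem_puncturedLocus hp p.2⟩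
  · exact LocalizedModule.smul_surjective_of_mem (p.1.asIdeal.primeCompl.pow_mem hp n) _

lemma toOpenₗ_puncturedOpens_injective (hx : IsSMulRegular M x)
    [IsHausdorff (Ideal.span {x}) M] :
    Function.Injective (toOpenₗ R M (puncturedOpens R)) := by
  refine (injective_iff_map_eq_zero _).2 fun m hm => ?_
  by_cases hxm : x ∈ maximalIdeal R
  · obtain ⟨e, he⟩ := toOpenₗ_eq_zero (basicOpen_le_puncturedSpectrum hxm) hm
    exact (hx.pow e) (he.trans (smul_zero _).symm)
  -- If `x` is a unit, separatedness forces `M = 0`.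
  · refine IsHausdorff.haus' (I := Ideal.span {x}) m fun n => ?_
    rw [Ideal.span_singleton_eq_top.2 (of_not_not hxm), Ideal.top_pow, Submodule.top_smul]
    exact SModEq.top

/-- Over the punctured spectrum, a section of the sheaf associated to `M` with values divisible by
all powers of `x` along `Y` vanishes. -/
lemma ModuleSections.eq_zero_of_germ [IsNoetherianRing R] [Module.Finite R M]
    (hx : IsSMulRegular M x) [IsHausdorff (Ideal.span {x}) M] (k : ℕ)
    (h : ∀ z : (localCohomology (maximalIdeal R) 1).obj (ModuleCat.of R M), x ^ k • z = 0)
    (s : ModuleSections M (puncturedOpens R))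
    (hs : ∀ (n : ℕ) (y : puncturedLocusTop (Ideal.span {x})), ∃ μ, x ^ n • μ = s.germ y) :
    s = 0 := by
  obtain ⟨m, hm⟩ := exists_pow_smul_eq_toOpenₗ (x ^ k) h s
  have hm0 : m = 0 := by
    refine IsHausdorff.haus' (I := Ideal.span {x}) m fun n => ?_
    rw [SModEq.zero, Submodule.mem_span_singleton_pow_smul_top]
    obtain ⟨t, ht⟩ := exists_pow_smul_eq_of_germ hx s (hs n)
    obtain ⟨m', hm'⟩ := exists_pow_smul_eq_toOpenₗ (x ^ k) h t
    refine ⟨m', toOpenₗ_puncturedOpens_injective hx ?_⟩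
    rw [map_smul, ← hm', smul_comm, ht, hm]
  refine smul_injective (hx.pow k) ?_
  rw [hm, hm0, map_zero, smul_zero]

theorem toCompletion_bijective [IsNoetherianRing R] [Module.Finite R M]
    (hx : IsSMulRegular M x) [IsAdicComplete (Ideal.span {x}) M] (k l : ℕ)
    (h₁ : ∀ z : (localCohomology (maximalIdeal R) 1).obj (ModuleCat.of R M), x ^ k • z = 0)
    (h₂ : ∀ z : (localCohomology (maximalIdeal R) 2).obj (ModuleCat.of R M), x ^ l • z = 0) :
    Function.Bijective (toCompletion (Ideal.span {x}) M) := by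
  constructor
  · refine (injective_iff_map_eq_zero _).2 fun s hs => ?_
    refine ModuleSections.eq_zero_of_germ hx k h₁ s fun n y => ?_
    rw [← LocalizedModule.mem_map_span_pow_smul_top, ← Submodule.Quotient.mk_eq_zero]
    exact congrArg (fun c => c.val n) (congrFun (congrArg Subtype.val hs) ⟨y, trivial⟩)
  · intro σ
    choose t ht using exists_section_germ_eq_mk hx l h₂ σ
    have ht' : ∀ {m n : ℕ}, m ≤ n → ∀ y, (σ.1 ⟨y, trivial⟩).val m =
        Submodule.Quotient.mk ((t n).germ y) :=
      fun hmn y => AdicCompletion.val_eq_mk_of_le hmn (ht _ y)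
    choose c hc using fun n => exists_pow_smul_eq_toOpenₗ (x ^ k) h₁ (t n)
    obtain ⟨L, hL⟩ := IsPrecomplete.prec' (I := Ideal.span {x}) c fun {m n} hmn => by
      rw [SModEq.sub_mem, Submodule.mem_span_singleton_pow_smul_top]
      -- If `t m - t n = xᵐ w`, then `c m - c n = xᵐ (xᵏ w)`, and `xᵏ w` comes from `M`: the
      -- sequence `c` is Cauchy in `M` itself.
      obtain ⟨w, hw⟩ := ModuleSections.exists_pow_smul_eq_of_germ hx (n := m) (t m - t n) (by
        intro y
        exact LocalizedModule.mem_map_span_pow_smul_top.1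
          ((Submodule.Quotient.eq _).1 ((ht m y).symm.trans (ht' hmn y))))
      obtain ⟨m', hm'⟩ := exists_pow_smul_eq_toOpenₗ (x ^ k) h₁ w
      refine ⟨m', toOpenₗ_puncturedOpens_injective hx ?_⟩
      rw [map_smul, ← hm', smul_comm, hw, smul_sub, hc, hc, map_sub]
    have hL' : ∀ n, ∃ d, x ^ n • d = L - c n := fun n => by
      rw [← Submodule.mem_span_singleton_pow_smul_top, ← SModEq.sub_mem]
      exact (hL n).symm
    choose d hd using hL'
    -- This is `L/xᵏ`: `xᵏ t k = c k` and `xᵏ d k = L - c k`.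
    let s : ModuleSections M (puncturedOpens R) := t k + toOpenₗ R M _ (d k)
    have hs : x ^ k • s = toOpenₗ R M _ L := by
      rw [smul_add, hc, ← map_smul, hd, ← map_add, add_sub_cancel]
    have hs' : ∀ n, s - t (n + k) = x ^ n • toOpenₗ R M _ (d (n + k)) := fun n => by
      refine ModuleSections.smul_injective (hx.pow k) ?_
      rw [smul_sub, hs, hc, ← map_sub, ← hd, ← map_smul, ← map_smul, ← mul_smul, ← pow_add,
        add_comm k]
    refine ⟨s, Subtype.ext (funext fun y => AdicCompletion.ext fun n => ?_)⟩
    refine Eq.trans ?_ (ht' (Nat.le_add_right n k) y.1).symm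
    refine (Submodule.Quotient.eq _).2 (LocalizedModule.mem_map_span_pow_smul_top.2
      ⟨ModuleSections.germ (toOpenₗ R M (puncturedOpens R) (d (n + k))) y.1, ?_⟩)
    exact (congrArg (fun s : ModuleSections M (puncturedOpens R) => s.germ y.1) (hs' n)).symm

end Comparison

/-! ### Finite length and completeness inputs for the generalized Cohen–Macaulay case. -/

section GeneralizedCohenMacaulay

variable {R : Type u} [CommRing R] [IsLocalRing R] {x : R}

/-- The maximal ideal kills every simple module, so each composition factor costs one power of `x`.
-/
lemma IsFiniteLength.exists_pow_smul_eq_zero (hx : x ∈ maximalIdeal R) {H : Type v}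
    [AddCommGroup H] [Module R H] (h : IsFiniteLength R H) : ∃ k : ℕ, ∀ z : H, x ^ k • z = 0 := by
  induction h with
  | of_subsingleton => exact ⟨0, fun z => Subsingleton.elim _ _⟩
  | @of_simple_quotient H _ _ N _ _ ih =>
    obtain ⟨k, hk⟩ := ih
    have hmax : (Module.annihilator R (H ⧸ N)).IsMaximal :=
      IsSimpleModule.annihilator_isMaximal
    rw [← IsLocalRing.eq_maximalIdeal hmax, Module.mem_annihilator] at hx
    refine ⟨k + 1, fun z => ?_⟩
    have hz : x • z ∈ N := (Submodule.Quotient.mk_eq_zero N).1 (hx (Submodule.Quotient.mk z))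
    rw [pow_succ, mul_smul]
    exact congrArg Subtype.val (hk ⟨x • z, hz⟩)

lemma isAdicComplete_span_singleton_of_mem_maximalIdeal [IsNoetherianRing R]
    [IsAdicComplete (maximalIdeal R) R] (hx : x ∈ maximalIdeal R) :
    IsAdicComplete (Ideal.span {x}) R := by
  have hle : ∀ n : ℕ, (Ideal.span {x} ^ n • ⊤ : Submodule R R) ≤ maximalIdeal R ^ n • ⊤ := fun n =>
    Submodule.smul_mono_left (Ideal.pow_right_mono ((Ideal.span_singleton_le_iff_mem _).2 hx) n)
  refine { haus' := fun z hz => ?_, prec' := fun f hf => ?_ }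
  · exact IsHausdorff.haus' (I := maximalIdeal R) z fun n => (hz n).mono (hle n)
  · obtain ⟨L, hL⟩ := IsPrecomplete.prec' (I := maximalIdeal R) f fun {m n} hmn =>
      (hf hmn).mono (hle m)
    refine ⟨L, fun n => ?_⟩
    rw [SModEq.sub_mem, ← Submodule.Quotient.mk_eq_zero]
    -- Modulo `xⁿ`, the element `f n - L` equals `f (n + j) - L ∈ 𝔪ʲ` for every `j`, so Krull's
    -- intersection theorem on `R/xⁿR` makes the `𝔪`-adic limit `L` an `x`-adic one.
    have key := Ideal.iInf_pow_smul_eq_bot_of_isLocalRing (M := R ⧸ (Ideal.span {x} ^ n • ⊤ :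
      Submodule R R)) (maximalIdeal R) (maximalIdeal.isMaximal R).ne_top
    rw [← Submodule.mem_bot R, ← key, Submodule.mem_iInf]
    intro j
    have h1 : f (n + j) - L ∈ (maximalIdeal R ^ j • ⊤ : Submodule R R) :=
      Submodule.smul_mono_left (Ideal.pow_le_pow_right (Nat.le_add_left j n))
        (SModEq.sub_mem.1 (hL (n + j)))
    have h2 := Submodule.mem_map_of_mem
      (f := Submodule.mkQ (Ideal.span {x} ^ n • ⊤ : Submodule R R)) h1
    rw [Submodule.map_smul''] at h2
    have h3 : (Submodule.Quotient.mk (f n - L) : R ⧸ (Ideal.span {x} ^ n • ⊤ : Submodule R R)) =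
        Submodule.mkQ _ (f (n + j) - L) := by
      refine (Submodule.Quotient.eq _).2 ?_
      rw [sub_sub_sub_cancel_right]
      exact SModEq.sub_mem.1 (hf (Nat.le_add_right n j))
    rw [h3]
    exact Submodule.smul_mono le_rfl le_top h2

end GeneralizedCohenMacaulay

theorem mainTheorem11 {R : Type u} [CommRing R] [IsLocalRing R] [IsNoetherianRing R] (x : R) :
    (∀ (M : Type u) [AddCommGroup M] [Module R M] [Module.Finite R M],
      IsSMulRegular M x →
      IsAdicComplete (Ideal.span {x}) M →
      (∃ k : ℕ, ∀ z : (localCohomology (maximalIdeal R) 1).obj (ModuleCat.of R M),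
        x ^ k • z = 0) →
      (∃ k : ℕ, ∀ z : (localCohomology (maximalIdeal R) 2).obj (ModuleCat.of R M),
        x ^ k • z = 0) →
      Function.Bijective (FormalGeometry.toCompletion (Ideal.span {x}) M)) ∧
    (IsAdicComplete (maximalIdeal R) R →
      FormalGeometry.IsGeneralizedCohenMacaulay R →
      2 < ringKrullDim R →
      x ∈ maximalIdeal R →
      IsSMulRegular R x →
      FormalGeometry.IsG2 (Ideal.span {x})) := by
  refine ⟨fun M _ _ _ hx _ ⟨k, h₁⟩ ⟨l, h₂⟩ => toCompletion_bijective hx k l h₁ h₂,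
    fun _ hR hdim hxm hx => ?_⟩
  have := isAdicComplete_span_singleton_of_mem_maximalIdeal hxm
  obtain ⟨k, h₁⟩ := (hR 1 (lt_trans (by norm_num) hdim)).exists_pow_smul_eq_zero hxm
  obtain ⟨l, h₂⟩ := (hR 2 hdim).exists_pow_smul_eq_zero hxm
  have H := toCompletion_bijective hx k l h₁ h₂
  -- The ring map and the module map for `M = R` have the same underlying function.
  refine ⟨fun s t h => H.1 (Subtype.ext (congrArg Subtype.val h)), fun σ => ?_⟩
  obtain ⟨s, hs⟩ := H.2 ⟨σ.1, σ.2⟩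
  exact ⟨s, Subtype.ext (congrArg Subtype.val hs)⟩
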